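/- Let $T$ be a complete first-order theory in a relational vocabulary containing a distinguished unary predicate $P$. Assume that $T$ has quantifier elimination (e.g. $T$ is Morleyized), that $T$ implies that $P$ is infinite, and that $P$ is stably embedded: in every model $N$ of $T$, each subset of a power $(P^N)^n$ that is definable with parameters from $N$ is definable with parameters from $P^N$. (By quantifier elimination, each $\emptyset$-definable subset of $(P^N)^n$ is then also $\emptyset$-definable in the substructure of $N$ with universe $P^N$.) Let $|T|=\max(\aleph_0,|L(T)|)$. A set is a subset of a model of $T$. A set $A\subseteq M\models T$ is \emph{complete} if for every formula $\psi(\bar x,\bar y)$ and every finite tuple $\bar b$ from $A$, if $M\models(\exists\bar x\subseteq P)\,\psi(\bar x,\bar b)$, then $M\models\psi(\bar a,\bar b)$ for some $\bar a\subseteq P^M\cap A$. For a set $A$, let $S_*(A)$ be the set of all types $\mathrm{tp}(\bar c/A)$, where $\bar c$ is a finite tuple from an elementary extension of $M$, $P\cap(A\cup\bar c)=P\cap A$, and $A\cup\bar c$ is complete. We write $A\equiv A'$ if $A$ and $A'$ are elementarily equivalent as substructures. A complete set $A$ is \emph{stable over $P$} if $|S_*(A')|\le|A'|^{|T|}$ for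 every subset $A'$ of a model of $T$ with $A'\equiv A$. \textbf{Lemma.} Let $A\subseteq M\models T$ be stable over $P$, and let $\bar a$ be a finite tuple from $M$ such that $A\bar a=A\cup\bar a$ is complete and $P\cap A\bar a=P\cap A$ (that is, $\mathrm{tp}(\bar a/A)\in S_*(A)$). Then $A\bar a$ is also stable over $P$. -/

import Mathlib

open FirstOrder Cardinal

universe u v w

namespace OverPredicate

variable {L : FirstOrder.Language.{u, v}}

/-- The interpretation `P^M` of the distinguished unary predicate `P` in a structure `M`. -/
def predSet (P : L.Relations 1) (M : Type w) [L.Structure M] : Set M :=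
  {x | FirstOrder.Language.Structure.RelMap P ![x]}

/-- Quantifier elimination: modulo `T`, every formula is equivalent to a quantifier-free one. -/
def HasQuantifierElimination (T : L.Theory) : Prop :=
  ∀ (n : ℕ) (φ : L.Formula (Fin n)),
    ∃ ψ : L.Formula (Fin n), FirstOrder.Language.BoundedFormula.IsQF ψ ∧ (φ ⇔[T] ψ)

/-- `T` implies that `P` is infinite. -/
def ImpliesInfinite (T : L.Theory) (P : L.Relations 1) : Prop :=
  ∀ (N : Type (max u v w)) [L.Structure N] [N ⊨ T], (predSet P N).Infinite

/-- `P` is stably embedded: in every model of `T`, each subset of a power `P ^ n` which is definable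
with arbitrary parameters is definable with parameters from `P`. -/
def IsStablyEmbedded (T : L.Theory) (P : L.Relations 1) : Prop :=
  ∀ (N : Type (max u v w)) [L.Structure N] [N ⊨ T] (n : ℕ) (D : Set (Fin n → N)),
    (∀ x ∈ D, ∀ i, x i ∈ predSet P N) →
      (Set.univ : Set N).Definable L D → (predSet P N).Definable L D

/-- The set `A ⊆ M` is complete: whenever a formula `ψ(x̄, b̄)` with parameters `b̄` in `A` has
a solution in `P`, it has a solution in `P ∩ A`. -/
def IsCompleteSet (P : L.Relations 1) {M : Type w} [L.Structure M] (A : Set M) : Prop :=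
  ∀ (k n : ℕ) (ψ : L.Formula (Fin k ⊕ Fin n)) (b : Fin n → M), (∀ i, b i ∈ A) →
    (∃ x : Fin k → M, (∀ i, x i ∈ predSet P M) ∧ ψ.Realize (Sum.elim x b)) →
      ∃ a : Fin k → M, (∀ i, a i ∈ predSet P M ∩ A) ∧ ψ.Realize (Sum.elim a b)

/-- The complete type `tp(c̄ / A)` of a tuple `c̄` in an elementary extension `f : M ↪ₑ N` over a set
`A ⊆ M`: the set of all formulas over `A` that hold of `c̄`. In `L.Formula (A ⊕ Fin m)` the variables
in the left summand stand for the parameters from `A`. -/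
def typeOver {M N : Type w} [L.Structure M] [L.Structure N] (f : M ↪ₑ[L] N) (A : Set M) {m : ℕ}
    (c : Fin m → N) : Set (L.Formula (A ⊕ Fin m)) :=
  {φ | φ.Realize (Sum.elim (fun a : A => f a) c)}

/-- The set of types `tp(c̄ / A)` of `m`-tuples `c̄` such that `P ∩ (A ∪ c̄) = P ∩ A` and `A ∪ c̄` is
complete. The tuples range over all elementary extensions of the ambient model, that is, over
the monster model. -/
def starTypes (P : L.Relations 1) {M : Type w} [L.Structure M] (A : Set M) (m : ℕ) :
    Set (Set (L.Formula (A ⊕ Fin m))) :=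
  {p | ∃ (N : Type w) (_ : L.Structure N) (f : M ↪ₑ[L] N) (c : Fin m → N),
      predSet P N ∩ (f '' A ∪ Set.range c) = predSet P N ∩ f '' A ∧
      IsCompleteSet P (f '' A ∪ Set.range c) ∧
      typeOver f A c = p}

/-- `S_*(A)`: the types in `starTypes P A m`, for all finite lengths `m` of tuples. -/
abbrev SStar (P : L.Relations 1) {M : Type w} [L.Structure M] (A : Set M) : Type (max u v w) :=
  Σ m : ℕ, starTypes P A m

/-- `|T|`: the number of formulas of the language of the complete theory `T`. -/
noncomputable def theoryCard (_T : L.Theory) : Cardinal.{max u v} :=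
  max ℵ₀ L.card

/-- The complete set `A` is stable over `P`: `|S_*(A')| ≤ |A'| ^ |T|` for every subset `A'` of a model
of `T` with `A' ≡ A`. For a relational language, `closure L A` is the substructure with
universe `A`. -/
def IsStableOver (T : L.Theory) (P : L.Relations 1) {M : Type (max u v w)} [L.Structure M]
    (A : Set M) : Prop :=
  IsCompleteSet P A ∧
    ∀ (N : Type (max u v w)) [L.Structure N] [N ⊨ T] (A' : Set N),
      (FirstOrder.Language.Substructure.closure L A' ≅[L]
        FirstOrder.Language.Substructure.closure L A) →
      #(SStar P A') ≤ #A' ^ Cardinal.lift.{w} (theoryCard T)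

end OverPredicate

/-! Let `B`, a subset of a model `N` of `T`, be elementarily equivalent to `A ∪ a`. One would like
to delete from `B` a copy of `a` and apply the stability of `A` to the rest, but the type of `a`
need not be realized in `B`. It is realized, by some `b`, in an ultrapower of `B` over at most `|T|`
indices (`exists_ultrapower_realizing`). Let `D` be this ultrapower without those `b j` for which `a
j ∉ A`. Since `A` is cut out of `A ∪ a` by the inequations `x ≠ a j`, relativization gives `D ≡ A`.
As `D` lies in the ultrapower of `N`, a model of `T`, stability of `A` yields `|S_*(D)| ≤ |D|^|T| ≤
(|B|^|T|)^|T| = |B|^|T|`.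

It remains to inject `S_*(B)` into `S_*(D)` (`card_sStar_le`). If `c` realizes a type in `S_*(B)`,
then `D ∪ b ∪ c` is the ultrapower of `B ∪ c`, hence complete, and its points in `P` lie in `D`. The
type of `bc` over `D` determines that of `c` over `B`, as each element of `B` is in `D` or among the
`b j`. -/

namespace OverPredicate

open FirstOrder.Language Filter

variable {L : FirstOrder.Language.{u, v}}

/-! ### Relativization to a definable substructure -/

section Relativization

variable {α : Type*}

/-- The relativization of a formula to the definable set `δ(-, s)`. -/
def relativize (δ : L.Formula (α ⊕ Unit)) :
    ∀ {k : ℕ}, L.BoundedFormula Empty k → L.BoundedFormula α k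
  | _, .falsum => .falsum
  | _, .equal t₁ t₂ =>
      .equal (t₁.relabel (Sum.map Empty.elim id)) (t₂.relabel (Sum.map Empty.elim id))
  | _, .rel R ts => .rel R fun i => (ts i).relabel (Sum.map Empty.elim id)
  | _, .imp φ ψ => .imp (relativize δ φ) (relativize δ ψ)
  | k, .all φ =>
      .all (BoundedFormula.imp
        (BoundedFormula.relabel (k := 0)
          (Sum.elim Sum.inl fun _ => Sum.inr (Fin.last k) : α ⊕ Unit → α ⊕ Fin (k + 1)) δ)
        (relativize δ φ))

theorem realize_relativize {K' K : Type*} [L.Structure K'] [L.Structure K] (e : K' ↪[L] K)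
    (δ : L.Formula (α ⊕ Unit)) (s : α → K)
    (he : ∀ x, x ∈ Set.range e ↔ δ.Realize (Sum.elim s fun _ => x))
    {k : ℕ} (φ : L.BoundedFormula Empty k) (v : Empty → K') (xs : Fin k → K') :
    (relativize δ φ).Realize s (e ∘ xs) ↔ φ.Realize v xs := by
  have key : ∀ {k : ℕ} (t : L.Term (Empty ⊕ Fin k)) (xs : Fin k → K'),
      (t.relabel (Sum.map (Empty.elim : Empty → α) id)).realize (Sum.elim s (e ∘ xs)) =
        e (t.realize (Sum.elim v xs)) := by
    intro k t xs
    rw [Term.realize_relabel, ← HomClass.realize_term]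
    congr 1
    funext i
    rcases i with i | i
    · exact i.elim
    · rfl
  induction φ with
  | falsum => rfl
  | equal t₁ t₂ =>
    simp only [relativize, BoundedFormula.Realize, key, e.injective.eq_iff]
  | rel R ts =>
    simp only [relativize, BoundedFormula.Realize, key]
    exact e.map_rel R _
  | imp φ ψ ih₁ ih₂ =>
    simp only [relativize, BoundedFormula.Realize, ih₁, ih₂]
  | @all k φ ih =>
    have hδ : ∀ x : K, (BoundedFormula.relabel (k := 0)
        (Sum.elim Sum.inl fun _ => Sum.inr (Fin.last k) : α ⊕ Unit → α ⊕ Fin (k + 1))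
        δ).Realize s (Fin.snoc (e ∘ xs) x : Fin (k + 1) → K) ↔ x ∈ Set.range e := by
      intro x
      rw [he, BoundedFormula.realize_relabel, Formula.Realize, iff_iff_eq]
      congr 1
      · funext i
        rcases i with i | i
        · rfl
        · simp
      · exact Subsingleton.elim _ _
    simp only [relativize, BoundedFormula.realize_all, BoundedFormula.realize_imp]
    constructor
    · intro h x
      have := h (e x) ((hδ _).2 ⟨x, rfl⟩)
      rw [← Fin.comp_snoc] at this
      exact (ih _).1 this
    · intro h x hx
      obtain ⟨y, rfl⟩ := (hδ x).1 hx
      rw [← Fin.comp_snoc]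
      exact (ih _).2 (h y)

/-- If two tuples have the same type, then the substructures on the sets that they define
by the same formula are elementarily equivalent. -/
theorem elementarilyEquivalent_of_definable {K₁' K₁ K₂' K₂ : Type*} [L.Structure K₁']
    [L.Structure K₁] [L.Structure K₂'] [L.Structure K₂] (e₁ : K₁' ↪[L] K₁) (e₂ : K₂' ↪[L] K₂)
    (s₁ : α → K₁) (s₂ : α → K₂)
    (hs : ∀ φ : L.Formula α, φ.Realize s₁ ↔ φ.Realize s₂)
    (δ : L.Formula (α ⊕ Unit))
    (h₁ : ∀ x, x ∈ Set.range e₁ ↔ δ.Realize (Sum.elim s₁ fun _ => x))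
    (h₂ : ∀ x, x ∈ Set.range e₂ ↔ δ.Realize (Sum.elim s₂ fun _ => x)) :
    K₁' ≅[L] K₂' := by
  rw [elementarilyEquivalent_iff]
  intro φ
  have r₁ := realize_relativize e₁ δ s₁ h₁ φ default default
  have r₂ := realize_relativize e₂ δ s₂ h₂ φ default default
  have r := hs (relativize δ φ)
  rw [Formula.Realize, Formula.Realize] at r
  rw [Subsingleton.elim (e₁ ∘ default) default] at r₁
  rw [Subsingleton.elim (e₂ ∘ default) default] at r₂
  exact r₁.symm.trans (r.trans r₂)

end Relativization

/-! ### Deleting finitely many points; embeddings -/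

/-- The formula saying that an element differs from the members of a tuple with index in `J`. -/
noncomputable def avoids (L : FirstOrder.Language.{u, v}) {n : ℕ} (J : Set (Fin n)) :
    L.Formula (Fin n ⊕ Unit) :=
  Formula.iInf fun j : J =>
    ((Term.var (Sum.inr ()) : L.Term (Fin n ⊕ Unit)).equal (Term.var (Sum.inl j.1))).not

theorem realize_avoids {n : ℕ} (J : Set (Fin n)) {K : Type*} [L.Structure K] (s : Fin n → K)
    (x : K) : (avoids L J).Realize (Sum.elim s fun _ => x) ↔ ∀ j ∈ J, x ≠ s j := by
  simp [avoids]

theorem mem_predSet_map {P : L.Relations 1} {K K' : Type*} [L.Structure K] [L.Structure K']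
    (e : K ↪[L] K') {x : K} : e x ∈ predSet P K' ↔ x ∈ predSet P K := by
  have h := e.map_rel P ![x]
  have e₁ : e ∘ ![x] = ![e x] := funext fun i => by rw [Subsingleton.elim i 0]; rfl
  rwa [e₁] at h

/-- An embedding whose range lies in the range of another one factors through it. -/
theorem exists_factor [L.IsRelational] {X Q N : Type*} [L.Structure X] [L.Structure Q]
    [L.Structure N] (e : X ↪[L] N) (ι : Q ↪[L] N) (h : ∀ x, e x ∈ Set.range ι) :
    ∃ e' : X ↪[L] Q, ∀ x, ι (e' x) = e x := by
  choose g hg using h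
  refine ⟨⟨⟨g, fun x y hxy => e.injective ?_⟩, fun f => isEmptyElim f, fun R x => ?_⟩, hg⟩
  · rw [← hg, ← hg, hxy]
  · rw [← e.map_rel, ← ι.map_rel]
    have : ι ∘ (g ∘ x) = e ∘ x := funext fun i => hg _
    exact this ▸ Iff.rfl

/-! ### Ultrapowers of structures and of their subsets -/

section Ultrapower

variable {I : Type*} (U : Ultrafilter I) {K K' : Type*}

/-- The ultrapower of a structure. -/
abbrev Ultrapower (K : Type*) : Type _ := (U : Filter I).Product fun _ : I => K

variable {U} in
/-- The element of the ultrapower represented by a function. -/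
def Ultrapower.mk (g : I → K) : Ultrapower U K := Quotient.mk'' (s₁ := Filter.productSetoid _ _) g

namespace Ultrapower

theorem mk_surjective : Function.Surjective (mk : (I → K) → Ultrapower U K) :=
  Quotient.mk''_surjective

variable {U}

theorem mk_eq_mk {g h : I → K} : (mk g : Ultrapower U K) = mk h ↔ ∀ᶠ i in U, g i = h i :=
  Quotient.eq''

theorem realize_mk [L.Structure K] [Nonempty K] {β : Type*} (φ : L.Formula β) (x : β → I → K) :
    (φ.Realize fun b => (mk (x b) : Ultrapower U K)) ↔
      ∀ᶠ i in U, φ.Realize fun b => x b i :=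
  Ultraproduct.realize_formula_cast φ x

theorem realize_const [L.Structure K] [Nonempty K] {β : Type*} (φ : L.Formula β) (x : β → K) :
    (φ.Realize fun b => (mk (fun _ => x b) : Ultrapower U K)) ↔ φ.Realize x := by
  rw [realize_mk, eventually_const]

theorem exists_rep {β : Type*} (x : β → Ultrapower U K) :
    ∃ g : β → I → K, x = fun b => mk (g b) := by
  choose g hg using fun b => mk_surjective U (x b)
  exact ⟨g, funext fun b => (hg b).symm⟩

theorem relMap_mk [L.Structure K] [Nonempty K] {n : ℕ} (R : L.Relations n) (x : Fin n → I → K) :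
    Structure.RelMap R (fun b => (mk (x b) : Ultrapower U K)) ↔
      ∀ᶠ i in U, Structure.RelMap R fun b => x b i := by
  have h := realize_mk (U := U) (R.formula fun b : Fin n => (Term.var b : L.Term (Fin n))) x
  simpa only [Formula.realize_rel, Term.realize_var] using h

theorem mk_mem_predSet [L.Structure K] [Nonempty K] {P : L.Relations 1} {g : I → K} :
    (mk g : Ultrapower U K) ∈ predSet P (Ultrapower U K) ↔ ∀ᶠ i in U, g i ∈ predSet P K := by
  have e₁ : (![mk g] : Fin 1 → Ultrapower U K) = fun _ => mk g :=
    funext fun i => by rw [Subsingleton.elim i 0]; rfl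
  have e₂ : ∀ i, (![g i] : Fin 1 → K) = fun _ => g i :=
    fun i => funext fun j => by rw [Subsingleton.elim j 0]; rfl
  simp only [predSet, Set.mem_ofPred_eq, e₁, e₂]
  exact relMap_mk P fun _ => g

/-- The map of ultrapowers induced by a map. -/
def map (U : Ultrafilter I) (f : K → K') : Ultrapower U K → Ultrapower U K' :=
  Quotient.map' (fun g i => f (g i)) fun _ _ h => h.mono fun _ hi => congrArg f hi

theorem map_mk (f : K → K') (g : I → K) : map U f (mk g) = mk fun i => f (g i) := rfl

/-- The embedding of ultrapowers induced by an embedding. -/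
def mapEmbedding [L.IsRelational] [L.Structure K] [L.Structure K'] [Nonempty K] [Nonempty K']
    (U : Ultrafilter I) (f : K ↪[L] K') : Ultrapower U K ↪[L] Ultrapower U K' where
  toFun := map U f
  inj' x y h := by
    obtain ⟨g, rfl⟩ := mk_surjective U x
    obtain ⟨g', rfl⟩ := mk_surjective U y
    rw [map_mk, map_mk, mk_eq_mk] at h
    exact mk_eq_mk.2 (h.mono fun _ hi => f.injective hi)
  map_fun' F := isEmptyElim F
  map_rel' R x := by
    obtain ⟨g, rfl⟩ := exists_rep x
    refine (relMap_mk R fun b i => f (g b i)).trans ?_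
    rw [relMap_mk]
    exact eventually_congr (Eventually.of_forall fun i => f.map_rel R fun b => g b i)

/-- The elementary embedding of ultrapowers induced by an elementary embedding. -/
def mapElementary [L.Structure K] [L.Structure K'] [Nonempty K] [Nonempty K']
    (U : Ultrafilter I) (f : K ↪ₑ[L] K') : Ultrapower U K ↪ₑ[L] Ultrapower U K' where
  toFun := map U f
  map_formula' n φ x := by
    obtain ⟨g, rfl⟩ := exists_rep x
    refine (realize_mk φ fun b i => f (g b i)).trans ?_
    rw [realize_mk]
    exact eventually_congr (Eventually.of_forall fun i => f.map_formula φ fun b => g b i)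

/-- The ultrapower of a subset. -/
def ofSet (U : Ultrafilter I) (C : Set K) : Set (Ultrapower U K) :=
  {x | ∃ g : I → K, mk g = x ∧ ∀ᶠ i in U, g i ∈ C}

theorem mk_mem_ofSet {C : Set K} {g : I → K} :
    (mk g : Ultrapower U K) ∈ ofSet U C ↔ ∀ᶠ i in U, g i ∈ C := by
  refine ⟨?_, fun h => ⟨g, rfl, h⟩⟩
  rintro ⟨g', hg', h⟩
  filter_upwards [mk_eq_mk.1 hg', h] with i h₁ h₂ using h₁ ▸ h₂

theorem ofSet_union (C D : Set K) : ofSet U (C ∪ D) = ofSet U C ∪ ofSet U D := by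
  ext x
  obtain ⟨g, rfl⟩ := mk_surjective U x
  simp only [Set.mem_union, mk_mem_ofSet, Ultrafilter.eventually_or]

theorem ofSet_image (f : K → K') (C : Set K) : ofSet U (f '' C) = map U f '' ofSet U C := by
  ext x
  constructor
  · rintro ⟨g, rfl, hg⟩
    -- The point `y₀` is only a default value for the negligible set of indices where `g i` has no
    -- preimage in `C`.
    obtain ⟨i₀, y₀, -, -⟩ := hg.exists
    classical
    refine ⟨mk fun i => if h : ∃ y ∈ C, f y = g i then h.choose else y₀,
      mk_mem_ofSet.2 (hg.mono fun i hi => ?_), mk_eq_mk.2 (hg.mono fun i hi => ?_)⟩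
    · have hi' : ∃ y ∈ C, f y = g i := hi
      simpa only [dif_pos hi'] using hi'.choose_spec.1
    · have hi' : ∃ y ∈ C, f y = g i := hi
      simpa only [dif_pos hi'] using hi'.choose_spec.2
  · rintro ⟨_, ⟨g, rfl, hg⟩, rfl⟩
    exact ⟨_, rfl, hg.mono fun i hi => ⟨_, hi, rfl⟩⟩

/-- A finite set gains no points in an ultrapower: an ultrafilter containing a finite union contains
one of its members. -/
theorem ofSet_range {m : ℕ} (c : Fin m → K) :
    ofSet U (Set.range c) = Set.range fun j => (mk fun _ => c j : Ultrapower U K) := by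
  ext x
  constructor
  · rintro ⟨g, rfl, hg⟩
    by_contra hx
    have h : ∀ j, ∀ᶠ i in U, ¬ c j = g i := fun j => by
      rw [Ultrafilter.eventually_not]
      exact fun h => hx ⟨j, mk_eq_mk.2 h⟩
    obtain ⟨i, ⟨j, hj⟩, hi⟩ := (hg.and (eventually_all.2 h)).exists
    exact hi j hj
  · rintro ⟨j, rfl⟩
    exact mk_mem_ofSet.2 (Eventually.of_forall fun _ => ⟨j, rfl⟩)

/-- The ultrapower of a complete set is complete. -/
theorem isCompleteSet_ofSet [L.Structure K] [Nonempty K] {P : L.Relations 1} {C : Set K}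
    (hC : IsCompleteSet P C) : IsCompleteSet P (ofSet U C) := by
  intro k n ψ b hb
  rintro ⟨x, hx, hψ⟩
  obtain ⟨g, rfl⟩ := exists_rep b
  obtain ⟨y, rfl⟩ := exists_rep x
  have split : ∀ z : Fin k → I → K, (ψ.Realize (Sum.elim (fun j => (mk (z j) : Ultrapower U K))
      fun j => mk (g j)) ↔ ∀ᶠ i in U, ψ.Realize (Sum.elim (fun j => z j i) fun j => g j i)) := by
    intro z
    have h := realize_mk (U := U) ψ (Sum.elim z g)
    have e₁ : (fun b => (mk (Sum.elim z g b) : Ultrapower U K)) =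
        Sum.elim (fun j => mk (z j)) fun j => mk (g j) := by
      funext b; rcases b with b | b <;> rfl
    have e₂ : ∀ i, (fun b => Sum.elim z g b i) = Sum.elim (fun j => z j i) fun j => g j i := by
      intro i; funext b; rcases b with b | b <;> rfl
    simpa only [e₁, e₂] using h
  rw [split] at hψ
  have hev : ∀ᶠ i in U, ∃ a : Fin k → K, (∀ j, a j ∈ predSet P K ∩ C) ∧
      ψ.Realize (Sum.elim a fun j => g j i) := by
    filter_upwards [eventually_all.2 fun j => mk_mem_ofSet.1 (hb j),
      eventually_all.2 fun j => mk_mem_predSet.1 (hx j), hψ] with i h₁ h₂ h₃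
    exact hC k n ψ _ h₁ ⟨_, h₂, h₃⟩
  obtain ⟨a, ha⟩ := skolem.1 hev
  refine ⟨fun j => mk fun i => a i j, fun j => ⟨mk_mem_predSet.2 ?_, mk_mem_ofSet.2 ?_⟩,
    (split fun j i => a i j).2 (ha.mono fun i hi => hi.2)⟩
  · exact ha.mono fun i hi => (hi.1 j).1
  · exact ha.mono fun i hi => (hi.1 j).2

theorem model {T : L.Theory} [L.Structure K] [Nonempty K] [hK : K ⊨ T] : Ultrapower U K ⊨ T := by
  rw [Theory.model_iff]
  intro φ hφ
  rw [Ultraproduct.sentence_realize]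
  exact Eventually.of_forall fun _ => Theory.realize_sentence_of_mem T hφ

theorem mk_card_le {I : Type u} (U : Ultrafilter I) (K : Type max u w) :
    #(Ultrapower U K) ≤ #K ^ Cardinal.lift.{w} #I := by
  refine Cardinal.mk_quotient_le.trans ?_
  rw [Cardinal.mk_arrow, Cardinal.lift_id'.{u, max u w}, Cardinal.lift_umax.{u, w}]

end Ultrapower

end Ultrapower

/-! ### Realizing a type in a small ultrapower -/

/-- A type of a finite tuple over the empty set is realized in an ultrapower of each elementarily
equivalent structure, with an index set no larger than the number of formulas. -/
theorem exists_ultrapower_realizing {K : Type*} {K' : Type*} [L.Structure K] [L.Structure K']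
    [Nonempty K'] (h : K ≅[L] K') {n : ℕ} (a : Fin n → K) :
    ∃ (I : Type max u v) (U : Ultrafilter I) (b : Fin n → Ultrapower U K'),
      #I ≤ max ℵ₀ L.card ∧ ∀ φ : L.Formula (Fin n), φ.Realize b ↔ φ.Realize a := by
  let I := {φ : L.Formula (Fin n) // φ.Realize a}
  have hex : ∀ φ : I, ∃ x : Fin n → K', φ.1.Realize x := by
    intro φ
    have hφ := h.realize_sentence (Formula.iExs (Fin n) (φ.1.relabel (Sum.inr : _ → Empty ⊕ _)))
    simp only [Sentence.Realize, Formula.realize_iExs, Formula.realize_relabel,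
      Sum.elim_comp_inr] at hφ
    exact hφ.1 ⟨a, φ.2⟩
  choose x hx using hex
  let X : I → Set I := fun ψ => {φ | ψ.1.Realize (x φ)}
  have : Nonempty I := ⟨⟨⊤, Formula.realize_top.2 trivial⟩⟩
  -- Closure of the type under conjunction gives the sets `X ψ` the finite intersection property, so
  -- some ultrafilter contains them all.
  have hdir : Directed (· ≥ ·) fun ψ : I => 𝓟 (X ψ) := by
    intro φ ψ
    refine ⟨⟨φ.1 ⊓ ψ.1, Formula.realize_inf.2 ⟨φ.2, ψ.2⟩⟩, ?_, ?_⟩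
    · exact principal_mono.2 fun θ hθ => (Formula.realize_inf.1 hθ).1
    · exact principal_mono.2 fun θ hθ => (Formula.realize_inf.1 hθ).2
  have : NeBot (⨅ ψ : I, 𝓟 (X ψ)) :=
    iInf_neBot_of_directed hdir fun ψ => principal_neBot_iff.2 ⟨ψ, hx ψ⟩
  obtain ⟨U, hU⟩ := Ultrafilter.exists_le (⨅ ψ : I, 𝓟 (X ψ))
  have hmem : ∀ ψ : I, ∀ᶠ φ in U, ψ.1.Realize (x φ) := fun ψ =>
    le_principal_iff.1 (hU.trans (iInf_le _ ψ))
  have hpos : ∀ φ : L.Formula (Fin n), φ.Realize a →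
      φ.Realize fun j => (Ultrapower.mk fun i => x i j : Ultrapower U K') := fun φ hφ =>
    (Ultrapower.realize_mk φ fun j i => x i j).2 (hmem ⟨φ, hφ⟩)
  refine ⟨I, U, fun j => Ultrapower.mk fun i => x i j, ?_, fun φ => ⟨fun hφ => ?_, hpos φ⟩⟩
  · have hinj : Function.Injective fun φ : I => (⟨0, φ.1⟩ : Σ k, L.BoundedFormula (Fin n) k) :=
      by
      intro φ ψ e
      exact Subtype.ext (by simpa using e)
    refine (Cardinal.mk_le_of_injective hinj).trans (BoundedFormula.card_le.trans ?_)
    simp only [Cardinal.mk_fin, Cardinal.lift_natCast, Cardinal.lift_uzero]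
    rw [max_le_iff]
    refine ⟨le_max_left _ _, ?_⟩
    refine (add_le_add_left (Cardinal.natCast_lt_aleph0.le) _).trans ?_
    rw [Cardinal.add_eq_max le_rfl]
  · by_contra hn
    exact hpos φ.not hn hφ

/-! ### Transfer of star types to the ultrapower -/

section StarTypes

open Ultrapower

variable {P : L.Relations 1} {I : Type max u v} {U : Ultrafilter I} {N : Type max u v w}
  [L.Structure N] {B : Set N} {D : Set (Ultrapower U N)} {n : ℕ} {b : Fin n → Ultrapower U N}

/-- The relabelling of variables induced by a map `τ` that sends each parameter to a new parameter
or to one of `n` new variables. -/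
def liftVars {B D : Type*} {n : ℕ} (τ : B → D ⊕ Fin n) (m : ℕ) :
    B ⊕ Fin m → D ⊕ Fin (n + m) :=
  Sum.elim (fun y => Sum.map id (Fin.castAdd m) (τ y)) fun j => Sum.inr (Fin.natAdd n j)

/-- A star type over `B` gives rise to a star type over a subset `D` of the ultrapower of `B`
whose complement is a finite tuple outside `P`, and it can be recovered from it. -/
theorem exists_starType [Nonempty N] (hDB : D ⊆ ofSet U B) (hb : ∀ j, b j ∈ ofSet U B)
    (hD : ∀ x ∈ ofSet U B, x ∉ D → x ∈ Set.range b)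
    (hP : ∀ x ∈ ofSet U B, x ∈ predSet P (Ultrapower U N) → x ∈ D)
    (τ : B → D ⊕ Fin n)
    (hτ : ∀ y : B, Sum.elim (fun x : D => x.1) b (τ y) = mk fun _ => y.1)
    {m : ℕ} {p : Set (L.Formula (B ⊕ Fin m))} (hp : p ∈ starTypes P B m) :
    ∃ q ∈ starTypes P D (n + m), ∀ φ : L.Formula (B ⊕ Fin m),
      φ ∈ p ↔ φ.relabel (liftVars τ m) ∈ q := by
  obtain ⟨N', _, f, c, hPc, hC, rfl⟩ := hp
  have : Nonempty N' := ⟨f (Classical.arbitrary N)⟩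
  let F : Ultrapower U N ↪ₑ[L] Ultrapower U N' := mapElementary U f
  let c' : Fin m → Ultrapower U N' := fun j => mk fun _ => c j
  have hF : ∀ S : Set N, ofSet U (f '' S) = F '' ofSet U S := fun S => ofSet_image f S
  have hset : F '' D ∪ Set.range (Fin.append (F ∘ b) c') = ofSet U (f '' B ∪ Set.range c) := by
    rw [ofSet_union, ofSet_range, hF]
    ext x
    constructor
    · rintro (⟨y, hy, rfl⟩ | ⟨j, rfl⟩)
      · exact Or.inl ⟨y, hDB hy, rfl⟩
      · refine Fin.addCases (fun j => ?_) (fun j => ?_) j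
        · rw [Fin.append_left]
          exact Or.inl ⟨_, hb j, rfl⟩
        · rw [Fin.append_right]
          exact Or.inr ⟨j, rfl⟩
    · rintro (⟨y, hy, rfl⟩ | ⟨j, rfl⟩)
      · by_cases hyD : y ∈ D
        · exact Or.inl ⟨y, hyD, rfl⟩
        · obtain ⟨j, rfl⟩ := hD y hy hyD
          exact Or.inr ⟨Fin.castAdd m j, Fin.append_left _ _ j⟩
      · exact Or.inr ⟨Fin.natAdd n j, Fin.append_right _ _ j⟩
  refine ⟨_, ⟨Ultrapower U N', inferInstance, F, Fin.append (F ∘ b) c', ?_, ?_, rfl⟩, ?_⟩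
  · refine Set.Subset.antisymm (fun x hx => ⟨hx.1, ?_⟩) fun x hx => ⟨hx.1, Or.inl hx.2⟩
    have hx₁ := hx.1
    have hx₂ := hx.2
    rw [hset] at hx₂
    obtain ⟨g, rfl⟩ := mk_surjective U x
    -- The condition on `P` for `c` over `B` is applied at almost every coordinate.
    have hg : ∀ᶠ i in U, g i ∈ f '' B := by
      filter_upwards [mk_mem_predSet.1 hx₁, mk_mem_ofSet.1 hx₂] with i h₁ h₂
      exact (hPc.subset ⟨h₁, h₂⟩).2
    have hg' := mk_mem_ofSet.2 hg
    rw [hF] at hg'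
    obtain ⟨y, hy, hyg⟩ := hg'
    refine ⟨y, hP y hy ?_, hyg⟩
    rw [← hyg] at hx₁
    exact (mem_predSet_map F.toEmbedding).1 hx₁
  · rw [hset]
    exact isCompleteSet_ofSet hC
  · intro φ
    change φ.Realize _ ↔ (φ.relabel _).Realize _
    -- The diagonal embedding is elementary, so `φ` may be tested on constant sequences.
    rw [Formula.realize_relabel, ← realize_const (U := U), iff_iff_eq]
    congr 1
    funext z
    rcases z with y | j
    · have h := congrArg F (hτ y)
      refine h.symm.trans ?_
      simp only [Function.comp_apply, liftVars, Sum.elim_inl]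
      rcases τ y with d | j
      · rfl
      · exact (Fin.append_left (F ∘ b) c' j).symm
    · exact (Fin.append_right (F ∘ b) c' j).symm

theorem card_sStar_le [Nonempty N] (hDB : D ⊆ ofSet U B) (hb : ∀ j, b j ∈ ofSet U B)
    (hD : ∀ x ∈ ofSet U B, x ∉ D → x ∈ Set.range b)
    (hP : ∀ x ∈ ofSet U B, x ∈ predSet P (Ultrapower U N) → x ∈ D) :
    #(SStar P B) ≤ #(SStar P D) := by
  have hex : ∀ y : B, ∃ z : D ⊕ Fin n, Sum.elim (fun x : D => x.1) b z = mk fun _ => y.1 := by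
    intro y
    by_cases hy : (mk fun _ => y.1) ∈ D
    · exact ⟨Sum.inl ⟨_, hy⟩, rfl⟩
    · obtain ⟨j, hj⟩ := hD _ (mk_mem_ofSet.2 (Eventually.of_forall fun _ => y.2)) hy
      exact ⟨Sum.inr j, hj⟩
  choose τ hτ using hex
  have key := fun p : SStar P B => exists_starType hDB hb hD hP τ hτ p.2.2
  choose q hq hpq using key
  refine Cardinal.mk_le_of_injective (f := fun p : SStar P B => ⟨n + p.1, ⟨q p, hq p⟩⟩) ?_
  rintro ⟨m, p⟩ ⟨m', p'⟩ h
  obtain rfl : m = m' := Nat.add_left_cancel (congrArg Sigma.fst h)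
  have h' : q ⟨m, p⟩ = q ⟨m, p'⟩ := by simpa using h
  have : p = p' := by
    refine Subtype.ext (Set.ext fun φ => ?_)
    rw [hpq ⟨m, p⟩ φ, hpq ⟨m, p'⟩ φ, h']
  rw [this]

end StarTypes

end OverPredicate

/-! ### The main theorem -/

theorem mainTheorem8 {L : FirstOrder.Language.{u, v}} [L.IsRelational]
    (T : L.Theory) (P : L.Relations 1)
    (hT : T.IsComplete) (hQE : OverPredicate.HasQuantifierElimination T)
    (hinf : OverPredicate.ImpliesInfinite.{u, v, w} T P)
    (hemb : OverPredicate.IsStablyEmbedded.{u, v, w} T P)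
    (M : Type (max u v w)) [L.Structure M] [M ⊨ T]
    (A : Set M) (hA : OverPredicate.IsStableOver.{u, v, w} T P A)
    (n : ℕ) (a : Fin n → M)
    (haP : OverPredicate.predSet P M ∩ (A ∪ Set.range a) = OverPredicate.predSet P M ∩ A)
    (haC : OverPredicate.IsCompleteSet P (A ∪ Set.range a)) :
    OverPredicate.IsStableOver.{u, v, w} T P (A ∪ Set.range a) := by
  open OverPredicate OverPredicate.Ultrapower FirstOrder.Language in
  -- The empty tuple is set apart because the ultrapower lemmas need nonempty structures.
  rcases isEmpty_or_nonempty (Fin n) with hn | ⟨⟨j₀⟩⟩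
  · rwa [Set.range_eq_empty, Set.union_empty]
  refine ⟨haC, fun N _ _ B hB => ?_⟩
  have memcl {X : Type (max u v w)} [L.Structure X] (S : Set X) (x : X) :
      x ∈ Substructure.closure L S ↔ x ∈ S := Substructure.mem_closure_iff_of_isRelational L S x
  let a' : Fin n → Substructure.closure L (A ∪ Set.range a) := fun j =>
    ⟨a j, (memcl _ _).2 (Or.inr ⟨j, rfl⟩)⟩
  have : Nonempty (Substructure.closure L (A ∪ Set.range a)) := ⟨a' j₀⟩
  have hBne : Nonempty (Substructure.closure L B) := hB.symm.nonempty
  have : Nonempty N := hBne.map Subtype.val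
  obtain ⟨I, U, b, hI, hb⟩ := exists_ultrapower_realizing hB.symm a'
  let ι : Ultrapower U (Substructure.closure L B) ↪[L] Ultrapower U N :=
    mapEmbedding U (Substructure.closure L B).subtype
  have hι : Set.range ι = ofSet U B := by
    have h := ofSet_image (U := U) (Subtype.val : Substructure.closure L B → N) Set.univ
    rw [Set.image_univ, Subtype.range_coe_subtype] at h
    have huniv : (ofSet U Set.univ : Set (Ultrapower U (Substructure.closure L B))) = Set.univ :=
      Set.eq_univ_of_forall fun x => by
        obtain ⟨g, rfl⟩ := mk_surjective U x
        exact mk_mem_ofSet.2 (Filter.Eventually.of_forall fun _ => trivial)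
    rw [huniv, Set.image_univ] at h
    exact h.symm.trans (congrArg _ (Set.ext fun x => memcl B x))
  -- Coordinates of `a` that already lie in `A` must not be deleted.
  let J : Set (Fin n) := {j | a j ∉ A}
  let D : Set (Ultrapower U N) := {x | x ∈ ofSet U B ∧ ∀ j ∈ J, x ≠ ι (b j)}
  have : Ultrapower U N ⊨ T := Ultrapower.model
  have hDA : Substructure.closure L D ≅[L] Substructure.closure L A := by
    obtain ⟨e₁, he₁⟩ := exists_factor (Substructure.closure L D).subtype ι fun x => by
      rw [hι]
      exact ((memcl D x.1).1 x.2).1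
    let e₂ : Substructure.closure L A ↪[L] Substructure.closure L (A ∪ Set.range a) :=
      Substructure.inclusion (Substructure.closure_mono Set.subset_union_left)
    refine elementarilyEquivalent_of_definable e₁ e₂ b a' hb (avoids L J) (fun x => ?_) fun x => ?_
    · rw [realize_avoids]
      constructor
      · rintro ⟨y, rfl⟩ j hj h
        refine ((memcl D y.1).1 y.2).2 j hj ?_
        rw [← h, he₁]
        rfl
      · intro h
        have hx : ι x ∈ D := ⟨hι ▸ ⟨x, rfl⟩, fun j hj e => h j hj (ι.injective e)⟩
        exact ⟨⟨ι x, (memcl D _).2 hx⟩, ι.injective (he₁ _)⟩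
    · rw [realize_avoids]
      constructor
      · rintro ⟨y, rfl⟩ j hj h
        have hy : y.1 = a j := congrArg Subtype.val h
        exact hj (hy ▸ (memcl A y.1).1 y.2)
      · intro h
        rcases (memcl _ x.1).1 x.2 with hx | ⟨j, hj⟩
        · exact ⟨⟨x.1, (memcl A _).2 hx⟩, Subtype.ext rfl⟩
        · by_cases hjA : a j ∈ A
          · exact ⟨⟨x.1, (memcl A _).2 (hj ▸ hjA)⟩, Subtype.ext rfl⟩
          · exact absurd (Subtype.ext hj.symm) (h j hjA)
  -- A deleted `b j` is outside `P`, since `a j ∉ A` forces `a j ∉ P` and the two tuples have the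
  -- same type.
  have hP : ∀ x ∈ ofSet U B, x ∈ predSet P (Ultrapower U N) → x ∈ D := by
    rintro x hx hxP
    refine ⟨hx, ?_⟩
    rintro j hj rfl
    rw [mem_predSet_map] at hxP
    have hPb := hb (P.formula₁ (Term.var j))
    rw [Formula.realize_rel₁, Formula.realize_rel₁] at hPb
    have haj : a' j ∈ predSet P (Substructure.closure L (A ∪ Set.range a)) := hPb.1 hxP
    have haj' := (mem_predSet_map (Substructure.subtype _)).2 haj
    exact hj (haP.subset ⟨haj', Or.inr ⟨j, rfl⟩⟩).2
  have hle := card_sStar_le (P := P) (B := B) (D := D) (b := fun j => ι (b j)) (fun x hx => hx.1)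
    (fun j => hι ▸ ⟨b j, rfl⟩) (fun x hx hxD => by
      by_contra h
      exact hxD ⟨hx, fun j _ e => h ⟨j, e.symm⟩⟩) hP
  have hcard : #D ≤ #B ^ Cardinal.lift.{w} (theoryCard T) := by
    have h₁ : #D ≤ #(Set.range ι) := Cardinal.mk_le_mk_of_subset fun x hx => hι ▸ hx.1
    have h₂ : #(Substructure.closure L B) = #B :=
      Cardinal.mk_congr (Equiv.subtypeEquivRight (memcl B))
    refine h₁.trans (Cardinal.mk_range_le.trans ((mk_card_le.{max u v, w} U _).trans ?_))
    rw [h₂]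
    refine Cardinal.power_le_power_left ?_ (Cardinal.lift_le.2 hI)
    rw [← h₂]
    exact Cardinal.mk_ne_zero _
  refine hle.trans ((hA.2 (Ultrapower U N) D hDA).trans ?_)
  refine (Cardinal.power_le_power_right hcard).trans ?_
  rw [← Cardinal.power_mul, Cardinal.mul_eq_self]
  rw [Cardinal.aleph0_le_lift]
  exact le_max_left _ _
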